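/- Let $E=(E^0,E^1,s,r)$ be a directed graph with at least one vertex (loops, multiple edges, and infinite sets of vertices and edges are allowed), where $s,r\colon E^1\to E^0$ are the source and range maps, and let $R$ be an associative unital ring. An $R$-ring is an associative, not necessarily unital, ring $S$ that is also an $R$-bimodule such that $(ss')c=s(s'c)$, $(cs)s'=c(ss')$ and $(sc)s'=s(cs')$ for all $c\in R$ and $s,s'\in S$. The Leavitt path ring $L_R(E)$ is the $R$-ring generated by $\{v\mid v\in E^0\}\cup\{f\mid f\in E^1\}\cup\{f^*\mid f\in E^1\}$ subject to the relations (i) $vw=\delta_{v,w}v$ for all $v,w\in E^0$; (ii) $s(f)f=f\,r(f)=f$ for all $f\in E^1$; (iii) $r(f)f^*=f^*s(f)=f^*$ for all $f\in E^1$; (iv) $f^*f'=\delta_{f,f'}r(f)$ for all $f,f'\in E^1$; (v) $\sum_{f\in E^1,\,s(f)=v}ff^*=v$ for every $v\in E^0$ with $s^{-1}(v)$ nonempty and finite; (vi) $cv=vc$, $cf=fc$ and $cf^*=f^*c$ for all $c\in R$, $v\in E^0$ and $f\in E^1$. A not necessarily unital ring $S$ is called prime if $S\neq\{0\}$ and,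 for all two-sided ideals $A,B$ of $S$, $AB=\{0\}$ implies $A=\{0\}$ or $B=\{0\}$. For $u,w\in E^0$ write $u\geq w$ if there is a path (possibly of length zero) from $u$ to $w$. The graph $E$ satisfies condition (MT-3) if for all $u,v\in E^0$ there is $w\in E^0$ with $u\geq w$ and $v\geq w$. Then $L_R(E)$ is prime if and only if $R$ is prime and $E$ satisfies condition (MT-3). -/

import Mathlib

universe u v w

/-- A two-sided ideal `P` of an associative, not necessarily unital, ring `S` is prime if it is
proper and, for all two-sided ideals `A`, `B` of `S`, `AB ⊆ P` implies `A ⊆ P` or `B ⊆ P`.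
Since `AB` consists of the finite sums of products `a * b` with `a ∈ A`, `b ∈ B`, and `P` is
closed under addition, `AB ⊆ P` says that `P` contains all these products. -/
def IsPrimeTwoSidedIdeal {S : Type u} [NonUnitalRing S] (P : TwoSidedIdeal S) : Prop :=
  P ≠ ⊤ ∧ ∀ A B : TwoSidedIdeal S, (∀ a ∈ A, ∀ b ∈ B, a * b ∈ P) → A ≤ P ∨ B ≤ P

/-- An associative, not necessarily unital, ring is prime if its zero ideal is prime. -/
def IsPrimeRing (S : Type u) [NonUnitalRing S] : Prop :=
  IsPrimeTwoSidedIdeal (⊥ : TwoSidedIdeal S)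

/-- A directed graph `(E⁰, E¹, s, r)`; loops, multiple edges, and infinitely many vertices and
edges are allowed. -/
structure DirectedGraph where
  /-- the set `E⁰` of vertices -/
  Vertex : Type v
  /-- the set `E¹` of edges -/
  Edge : Type w
  /-- the source map -/
  s : Edge → Vertex
  /-- the range map -/
  r : Edge → Vertex

namespace DirectedGraph

/-- `E.IsPath u l x`: the sequence `l = f₁ f₂ … fₙ` of edges is a path from `u` to `x`, i.e.
`s f₁ = u`, `r fᵢ = s fᵢ₊₁` and `r fₙ = x`; the empty sequence is the path of length zero at
`u = x`. -/
def IsPath (E : DirectedGraph.{v, w}) : E.Vertex → List E.Edge → E.Vertex → Prop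
  | u, [], x => u = x
  | u, f :: l, x => E.s f = u ∧ E.IsPath (E.r f) l x

/-- The preorder `u ≥ x` on vertices: there is a path from `u` to `x`. -/
def Reaches (E : DirectedGraph.{v, w}) (u x : E.Vertex) : Prop :=
  ∃ l : List E.Edge, E.IsPath u l x

/-- Condition (MT-3). -/
def MT3 (E : DirectedGraph.{v, w}) : Prop :=
  ∀ u x : E.Vertex, ∃ y : E.Vertex, E.Reaches u y ∧ E.Reaches x y

end DirectedGraph

namespace LeavittPathRing

/-- Formal expressions in the generators `v`, `f`, `f*`, built with the operations of an
`R`-ring: addition, negation, multiplication and multiplication by scalars on either side. -/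
inductive Term (R : Type u) (E : DirectedGraph.{v, w}) : Type (max u v w)
  | vertex (x : E.Vertex) : Term R E
  | edge (f : E.Edge) : Term R E
  | ghost (f : E.Edge) : Term R E
  | zero : Term R E
  | add (a b : Term R E) : Term R E
  | neg (a : Term R E) : Term R E
  | mul (a b : Term R E) : Term R E
  | lsmul (c : R) (a : Term R E) : Term R E
  | rsmul (a : Term R E) (c : R) : Term R E

/-- The formal sum of a list of expressions. -/
def Term.sum {R : Type u} {E : DirectedGraph.{v, w}} : List (Term R E) → Term R E
  | [] => Term.zero
  | a :: l => Term.add a (Term.sum l)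

open Term in
/-- The relations between expressions: the axioms of an (associative, not necessarily unital)
`R`-ring, compatibility with all operations, and the defining relations of the Leavitt path
ring. -/
inductive Rel (R : Type u) [Ring R] (E : DirectedGraph.{v, w}) : Term R E → Term R E → Prop
  -- compatibility with the operations
  | add_congr_left {a a' : Term R E} (b : Term R E) :
      Rel R E a a' → Rel R E (add a b) (add a' b)
  | add_congr_right (a : Term R E) {b b' : Term R E} :
      Rel R E b b' → Rel R E (add a b) (add a b')
  | neg_congr {a a' : Term R E} : Rel R E a a' → Rel R E (neg a) (neg a')
  | mul_congr_left {a a' : Term R E} (b : Term R E) :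
      Rel R E a a' → Rel R E (mul a b) (mul a' b)
  | mul_congr_right (a : Term R E) {b b' : Term R E} :
      Rel R E b b' → Rel R E (mul a b) (mul a b')
  | lsmul_congr (c : R) {a a' : Term R E} : Rel R E a a' → Rel R E (lsmul c a) (lsmul c a')
  | rsmul_congr (c : R) {a a' : Term R E} : Rel R E a a' → Rel R E (rsmul a c) (rsmul a' c)
  -- ring axioms
  | add_assoc (a b c : Term R E) : Rel R E (add (add a b) c) (add a (add b c))
  | add_comm (a b : Term R E) : Rel R E (add a b) (add b a)
  | zero_add (a : Term R E) : Rel R E (add zero a) a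
  | neg_add_cancel (a : Term R E) : Rel R E (add (neg a) a) zero
  | mul_assoc (a b c : Term R E) : Rel R E (mul (mul a b) c) (mul a (mul b c))
  | left_distrib (a b c : Term R E) : Rel R E (mul a (add b c)) (add (mul a b) (mul a c))
  | right_distrib (a b c : Term R E) : Rel R E (mul (add a b) c) (add (mul a c) (mul b c))
  -- unital `R`-bimodule axioms
  | lsmul_add (c : R) (a b : Term R E) :
      Rel R E (lsmul c (add a b)) (add (lsmul c a) (lsmul c b))
  | add_lsmul (c d : R) (a : Term R E) :
      Rel R E (lsmul (c + d) a) (add (lsmul c a) (lsmul d a))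
  | mul_lsmul (c d : R) (a : Term R E) : Rel R E (lsmul (c * d) a) (lsmul c (lsmul d a))
  | one_lsmul (a : Term R E) : Rel R E (lsmul 1 a) a
  | rsmul_add (c : R) (a b : Term R E) :
      Rel R E (rsmul (add a b) c) (add (rsmul a c) (rsmul b c))
  | add_rsmul (c d : R) (a : Term R E) :
      Rel R E (rsmul a (c + d)) (add (rsmul a c) (rsmul a d))
  | mul_rsmul (c d : R) (a : Term R E) : Rel R E (rsmul a (c * d)) (rsmul (rsmul a c) d)
  | one_rsmul (a : Term R E) : Rel R E (rsmul a 1) a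
  | lsmul_rsmul (c d : R) (a : Term R E) :
      Rel R E (rsmul (lsmul c a) d) (lsmul c (rsmul a d))
  -- compatibility of the bimodule structure with the multiplication
  | mul_rsmul_assoc (a b : Term R E) (c : R) : Rel R E (rsmul (mul a b) c) (mul a (rsmul b c))
  | lsmul_mul_assoc (c : R) (a b : Term R E) : Rel R E (mul (lsmul c a) b) (lsmul c (mul a b))
  | rsmul_mul (a : Term R E) (c : R) (b : Term R E) :
      Rel R E (mul (rsmul a c) b) (mul a (lsmul c b))
  -- (i) `v w = δ_{v,w} v`
  | vertex_mul_self (x : E.Vertex) : Rel R E (mul (vertex x) (vertex x)) (vertex x)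
  | vertex_mul_of_ne (x y : E.Vertex) : x ≠ y → Rel R E (mul (vertex x) (vertex y)) zero
  -- (ii) `s(f) f = f r(f) = f`
  | source_mul_edge (f : E.Edge) : Rel R E (mul (vertex (E.s f)) (edge f)) (edge f)
  | edge_mul_range (f : E.Edge) : Rel R E (mul (edge f) (vertex (E.r f))) (edge f)
  -- (iii) `r(f) f* = f* s(f) = f*`
  | range_mul_ghost (f : E.Edge) : Rel R E (mul (vertex (E.r f)) (ghost f)) (ghost f)
  | ghost_mul_source (f : E.Edge) : Rel R E (mul (ghost f) (vertex (E.s f))) (ghost f)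
  -- (iv) `f* f' = δ_{f,f'} r(f)`
  | ghost_mul_edge_self (f : E.Edge) : Rel R E (mul (ghost f) (edge f)) (vertex (E.r f))
  | ghost_mul_edge_of_ne (f g : E.Edge) : f ≠ g → Rel R E (mul (ghost f) (edge g)) zero
  -- (v) `∑_{s(f) = v} f f* = v` if `s⁻¹(v)` is nonempty and finite; the list `l` enumerates
  -- `s⁻¹(v)` without repetitions
  | sum_edge_mul_ghost (x : E.Vertex) (l : List E.Edge) :
      l ≠ [] → l.Nodup → (∀ f : E.Edge, f ∈ l ↔ E.s f = x) →
      Rel R E (Term.sum (l.map fun f => mul (edge f) (ghost f))) (vertex x)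
  -- (vi) the generators commute with the scalars
  | lsmul_vertex (c : R) (x : E.Vertex) : Rel R E (lsmul c (vertex x)) (rsmul (vertex x) c)
  | lsmul_edge (c : R) (f : E.Edge) : Rel R E (lsmul c (edge f)) (rsmul (edge f) c)
  | lsmul_ghost (c : R) (f : E.Edge) : Rel R E (lsmul c (ghost f)) (rsmul (ghost f) c)

end LeavittPathRing

/-- The Leavitt path ring `L_R(E)`: the associative, not necessarily unital, `R`-ring generated by
`{v | v ∈ E⁰} ∪ {f | f ∈ E¹} ∪ {f* | f ∈ E¹}` subject to the relations (i)-(vi) above, that is, the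
quotient of the expressions by the equivalence relation generated by `LeavittPathRing.Rel`. -/
def LeavittPathRing (R : Type u) [Ring R] (E : DirectedGraph.{v, w}) : Type (max u v w) :=
  Quot (LeavittPathRing.Rel R E)

namespace LeavittPathRing

section

variable {R : Type u} [Ring R] {E : DirectedGraph.{v, w}}

instance : Add (LeavittPathRing R E) :=
  ⟨Quot.map₂ Term.add (fun a _ _ h => Rel.add_congr_right a h)
    (fun _ _ b h => Rel.add_congr_left b h)⟩

instance : Zero (LeavittPathRing R E) := ⟨Quot.mk _ Term.zero⟩

instance : Neg (LeavittPathRing R E) := ⟨Quot.map Term.neg fun _ _ h => Rel.neg_congr h⟩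

instance : Mul (LeavittPathRing R E) :=
  ⟨Quot.map₂ Term.mul (fun a _ _ h => Rel.mul_congr_right a h)
    (fun _ _ b h => Rel.mul_congr_left b h)⟩

/-- The left action of `R`. -/
instance : SMul R (LeavittPathRing R E) :=
  ⟨fun c => Quot.map (Term.lsmul c) fun _ _ h => Rel.lsmul_congr c h⟩

/-- The right action of `R`. -/
instance : SMul (MulOpposite R) (LeavittPathRing R E) :=
  ⟨fun c => Quot.map (fun a => Term.rsmul a c.unop) fun _ _ h => Rel.rsmul_congr c.unop h⟩

instance : AddCommGroup (LeavittPathRing R E) :=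
  { AddGroup.ofLeftAxioms
      (by rintro ⟨a⟩ ⟨b⟩ ⟨c⟩; exact Quot.sound (Rel.add_assoc a b c))
      (by rintro ⟨a⟩; exact Quot.sound (Rel.zero_add a))
      (by rintro ⟨a⟩; exact Quot.sound (Rel.neg_add_cancel a)) with
    add_comm := by rintro ⟨a⟩ ⟨b⟩; exact Quot.sound (Rel.add_comm a b) }

protected theorem mul_add' (a b c : LeavittPathRing R E) : a * (b + c) = a * b + a * c := by
  obtain ⟨a⟩ := a
  obtain ⟨b⟩ := b
  obtain ⟨c⟩ := c
  exact Quot.sound (Rel.left_distrib a b c)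

protected theorem add_mul' (a b c : LeavittPathRing R E) : (a + b) * c = a * c + b * c := by
  obtain ⟨a⟩ := a
  obtain ⟨b⟩ := b
  obtain ⟨c⟩ := c
  exact Quot.sound (Rel.right_distrib a b c)

instance : NonUnitalRing (LeavittPathRing R E) :=
  { (inferInstance : AddCommGroup (LeavittPathRing R E)),
    (inferInstance : Mul (LeavittPathRing R E)) with
    left_distrib := LeavittPathRing.mul_add'
    right_distrib := LeavittPathRing.add_mul'
    zero_mul := fun a => by
      have h := LeavittPathRing.add_mul' 0 0 a
      rw [add_zero] at h
      exact left_eq_add.mp h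
    mul_zero := fun a => by
      have h := LeavittPathRing.mul_add' a 0 0
      rw [add_zero] at h
      exact left_eq_add.mp h
    mul_assoc := by rintro ⟨a⟩ ⟨b⟩ ⟨c⟩; exact Quot.sound (Rel.mul_assoc a b c) }

instance : Module R (LeavittPathRing R E) :=
  Module.ofMinimalAxioms
    (by rintro c ⟨a⟩ ⟨b⟩; exact Quot.sound (Rel.lsmul_add c a b))
    (by rintro c d ⟨a⟩; exact Quot.sound (Rel.add_lsmul c d a))
    (by rintro c d ⟨a⟩; exact Quot.sound (Rel.mul_lsmul c d a))
    (by rintro ⟨a⟩; exact Quot.sound (Rel.one_lsmul a))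

instance : Module (MulOpposite R) (LeavittPathRing R E) :=
  Module.ofMinimalAxioms
    (by rintro c ⟨a⟩ ⟨b⟩; exact Quot.sound (Rel.rsmul_add c.unop a b))
    (by rintro c d ⟨a⟩; exact Quot.sound (Rel.add_rsmul c.unop d.unop a))
    (by rintro c d ⟨a⟩; exact Quot.sound (Rel.mul_rsmul d.unop c.unop a))
    (by rintro ⟨a⟩; exact Quot.sound (Rel.one_rsmul a))

end

end LeavittPathRing

/-! For sufficiency, every nonzero ideal is shown to contain some `c v + n` with `c ≠ 0` a scalar,
`v` a vertex and `n` of degree at most −1. To get there, a nonzero element is written as a sum of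
monomials `p q*`. Multiplying by edges on the right shortens the ghost parts until only paths remain
(`exists_mem_pathSpan_of_mem_ideal`); multiplying by ghost edges on the left then strips the paths
down to a vertex (`exists_mul_eq_smul_vertex_add`). Conjugation `f* _ f` moves `v` along edges, so
by (MT-3) two nonzero ideals contain `a z + n` and `b z + m` for a common vertex `z`. If their
product is zero, then `(a z + n)(s z)(b z + m) = 0` puts `(a s b) z` in degree at most −1. Hence `a
s b = 0` for all `s`, contradicting primeness of `R`.

Degrees are measured by a representation on `R`-valued functions on points that behave like infinite
paths: edges raise the degree by one, ghost edges lower it by one. All that is needed is this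
filtration and the fact that `c v` with `c ≠ 0` is not of negative degree
(`eq_zero_of_smul_vertex_mem_degreeLE`); no normal form for elements is required.

For necessity, if `x` and `y` reach no common vertex, then `x L y = 0`. If `AB = 0` in `R`, the
annihilator of `A` in `L` is an ideal that contains `B v` and is killed on the left by `A v`. -/

namespace LeavittPathRing

/-! ### Generators, relations and local units -/

section Generators

variable (R : Type u) [Ring R] {E : DirectedGraph.{v, w}}

/-- A vertex, as an element of the Leavitt path ring. -/
def vertex (x : E.Vertex) : LeavittPathRing R E := Quot.mk _ (Term.vertex x)

/-- An edge, as an element of the Leavitt path ring. -/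
def edge (f : E.Edge) : LeavittPathRing R E := Quot.mk _ (Term.edge f)

/-- A ghost edge, as an element of the Leavitt path ring. -/
def ghost (f : E.Edge) : LeavittPathRing R E := Quot.mk _ (Term.ghost f)

variable {R}

@[elab_as_elim]
theorem generator_induction {p : LeavittPathRing R E → Prop}
    (vertex : ∀ x, p (vertex R x)) (edge : ∀ f, p (edge R f)) (ghost : ∀ f, p (ghost R f))
    (zero : p 0) (add : ∀ a b, p a → p b → p (a + b)) (neg : ∀ a, p a → p (-a))
    (mul : ∀ a b, p a → p b → p (a * b)) (smul : ∀ (c : R) a, p a → p (c • a))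
    (op_smul : ∀ (c : R) a, p a → p (MulOpposite.op c • a)) (x : LeavittPathRing R E) : p x := by
  obtain ⟨t⟩ := x
  induction t with
  | vertex x => exact vertex x
  | edge f => exact edge f
  | ghost f => exact ghost f
  | zero => exact zero
  | add a b ha hb => exact add _ _ ha hb
  | neg a ha => exact neg _ ha
  | mul a b ha hb => exact mul _ _ ha hb
  | lsmul c a ha => exact smul c _ ha
  | rsmul a c ha => exact op_smul c _ ha

instance : IsScalarTower R (LeavittPathRing R E) (LeavittPathRing R E) where
  smul_assoc := by rintro c ⟨a⟩ ⟨b⟩; exact Quot.sound (Rel.lsmul_mul_assoc c a b)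

instance : SMulCommClass R Rᵐᵒᵖ (LeavittPathRing R E) where
  smul_comm := by rintro c d ⟨a⟩; exact (Quot.sound (Rel.lsmul_rsmul c d.unop a)).symm

theorem op_smul_mul (c : R) (a b : LeavittPathRing R E) :
    (MulOpposite.op c • a) * b = a * (c • b) := by
  obtain ⟨a⟩ := a
  obtain ⟨b⟩ := b
  exact Quot.sound (Rel.rsmul_mul a c b)

theorem mul_op_smul (c : R) (a b : LeavittPathRing R E) :
    a * (MulOpposite.op c • b) = MulOpposite.op c • (a * b) := by
  obtain ⟨a⟩ := a
  obtain ⟨b⟩ := b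
  exact (Quot.sound (Rel.mul_rsmul_assoc a b c)).symm

theorem op_smul_vertex (c : R) (x : E.Vertex) : MulOpposite.op c • vertex R x = c • vertex R x :=
  (Quot.sound (Rel.lsmul_vertex c x)).symm

theorem op_smul_edge (c : R) (f : E.Edge) : MulOpposite.op c • edge R f = c • edge R f :=
  (Quot.sound (Rel.lsmul_edge c f)).symm

theorem op_smul_ghost (c : R) (f : E.Edge) : MulOpposite.op c • ghost R f = c • ghost R f :=
  (Quot.sound (Rel.lsmul_ghost c f)).symm

/-- The scalar crosses the product and then, by (vi), the generator. For a general left factor this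
fails, since `R` is not commutative. -/
theorem vertex_mul_smul (x : E.Vertex) (c : R) (a : LeavittPathRing R E) :
    vertex R x * (c • a) = c • (vertex R x * a) := by
  rw [← op_smul_mul, op_smul_vertex, smul_mul_assoc]

theorem edge_mul_smul (f : E.Edge) (c : R) (a : LeavittPathRing R E) :
    edge R f * (c • a) = c • (edge R f * a) := by
  rw [← op_smul_mul, op_smul_edge, smul_mul_assoc]

theorem ghost_mul_smul (f : E.Edge) (c : R) (a : LeavittPathRing R E) :
    ghost R f * (c • a) = c • (ghost R f * a) := by
  rw [← op_smul_mul, op_smul_ghost, smul_mul_assoc]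

@[simp]
theorem vertex_mul_vertex_self (x : E.Vertex) : vertex R x * vertex R x = vertex R x :=
  Quot.sound (Rel.vertex_mul_self x)

theorem vertex_mul_vertex_of_ne {x y : E.Vertex} (h : x ≠ y) : vertex R x * vertex R y = 0 :=
  Quot.sound (Rel.vertex_mul_of_ne x y h)

@[simp]
theorem vertex_source_mul_edge (f : E.Edge) : vertex R (E.s f) * edge R f = edge R f :=
  Quot.sound (Rel.source_mul_edge f)

@[simp]
theorem edge_mul_vertex_range (f : E.Edge) : edge R f * vertex R (E.r f) = edge R f :=
  Quot.sound (Rel.edge_mul_range f)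

@[simp]
theorem vertex_range_mul_ghost (f : E.Edge) : vertex R (E.r f) * ghost R f = ghost R f :=
  Quot.sound (Rel.range_mul_ghost f)

@[simp]
theorem ghost_mul_vertex_source (f : E.Edge) : ghost R f * vertex R (E.s f) = ghost R f :=
  Quot.sound (Rel.ghost_mul_source f)

@[simp]
theorem ghost_mul_edge_self (f : E.Edge) : ghost R f * edge R f = vertex R (E.r f) :=
  Quot.sound (Rel.ghost_mul_edge_self f)

theorem ghost_mul_edge_of_ne {f g : E.Edge} (h : f ≠ g) : ghost R f * edge R g = 0 :=
  Quot.sound (Rel.ghost_mul_edge_of_ne f g h)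

theorem vertex_mul_edge_of_ne {x : E.Vertex} {f : E.Edge} (h : x ≠ E.s f) :
    vertex R x * edge R f = 0 := by
  rw [← vertex_source_mul_edge, ← mul_assoc, vertex_mul_vertex_of_ne h, zero_mul]

theorem edge_mul_vertex_of_ne {x : E.Vertex} {f : E.Edge} (h : E.r f ≠ x) :
    edge R f * vertex R x = 0 := by
  rw [← edge_mul_vertex_range, mul_assoc, vertex_mul_vertex_of_ne h, mul_zero]

theorem ghost_mul_vertex_of_ne {x : E.Vertex} {f : E.Edge} (h : E.s f ≠ x) :
    ghost R f * vertex R x = 0 := by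
  rw [← ghost_mul_vertex_source, mul_assoc, vertex_mul_vertex_of_ne h, mul_zero]

theorem sum_edge_mul_ghost {x : E.Vertex} {F : Finset E.Edge} (hne : F.Nonempty)
    (hF : ∀ f, f ∈ F ↔ E.s f = x) : ∑ f ∈ F, edge R f * ghost R f = vertex R x := by
  have key : ∀ l : List E.Edge, (Quot.mk _ (Term.sum (l.map fun f =>
      Term.mul (Term.edge f) (Term.ghost f))) : LeavittPathRing R E) =
      (l.map fun f => edge R f * ghost R f).sum := by
    intro l
    induction l with
    | nil => rfl
    | cons f l ih => rw [List.map_cons, List.map_cons, List.sum_cons, ← ih]; rfl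
  rw [← Finset.sum_map_toList, ← key]
  exact Quot.sound (Rel.sum_edge_mul_ghost x F.toList
    (by simpa [Finset.toList_eq_nil] using hne.ne_empty) F.nodup_toList (by simpa using hF))

-- Finite sums of vertices replace the unit, which is missing when there are infinitely many
-- vertices. Allowing every larger `T'` lets the sets for two summands be united.
open scoped Classical in
theorem exists_mul_sum_vertex_eq (x : LeavittPathRing R E) :
    ∃ T : Finset E.Vertex, ∀ T', T ⊆ T' → x * ∑ v ∈ T', vertex R v = x := by
  induction x using generator_induction with
  | vertex y =>
    refine ⟨{y}, fun T hT => ?_⟩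
    rw [Finset.mul_sum, Finset.sum_eq_single_of_mem y (hT (by simp)), vertex_mul_vertex_self]
    exact fun z _ hz => vertex_mul_vertex_of_ne hz.symm
  | edge f =>
    refine ⟨{E.r f}, fun T hT => ?_⟩
    rw [Finset.mul_sum, Finset.sum_eq_single_of_mem (E.r f) (hT (by simp)), edge_mul_vertex_range]
    exact fun z _ hz => edge_mul_vertex_of_ne hz.symm
  | ghost f =>
    refine ⟨{E.s f}, fun T hT => ?_⟩
    rw [Finset.mul_sum, Finset.sum_eq_single_of_mem (E.s f) (hT (by simp)),
      ghost_mul_vertex_source]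
    exact fun z _ hz => ghost_mul_vertex_of_ne hz.symm
  | zero => exact ⟨∅, fun _ _ => zero_mul _⟩
  | add a b ha hb =>
    obtain ⟨S, hS⟩ := ha
    obtain ⟨T, hT⟩ := hb
    refine ⟨S ∪ T, fun U hU => ?_⟩
    rw [add_mul, hS U (Finset.union_subset_left hU), hT U (Finset.union_subset_right hU)]
  | neg a ha =>
    obtain ⟨S, hS⟩ := ha
    exact ⟨S, fun U hU => by rw [neg_mul, hS U hU]⟩
  | mul a b _ hb =>
    obtain ⟨S, hS⟩ := hb
    exact ⟨S, fun U hU => by rw [mul_assoc, hS U hU]⟩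
  | smul c a ha =>
    obtain ⟨S, hS⟩ := ha
    exact ⟨S, fun U hU => by rw [smul_mul_assoc, hS U hU]⟩
  | op_smul c a ha =>
    obtain ⟨S, hS⟩ := ha
    refine ⟨S, fun U hU => ?_⟩
    conv_rhs => rw [← hS U hU]
    -- On both sides the scalar now acts on the sum of vertices, where the left and right actions
    -- agree by (vi).
    rw [op_smul_mul, ← mul_op_smul, Finset.smul_sum, Finset.smul_sum]
    simp only [op_smul_vertex]

theorem exists_mul_vertex_ne_zero {x : LeavittPathRing R E} (hx : x ≠ 0) :
    ∃ y, x * vertex R y ≠ 0 := by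
  by_contra! h
  obtain ⟨T, hT⟩ := exists_mul_sum_vertex_eq x
  apply hx
  rw [← hT T subset_rfl, Finset.mul_sum]
  exact Finset.sum_eq_zero fun y _ => h y

end Generators

/-! ### A graded representation -/

section Representation

variable (E : DirectedGraph.{v, w})

/-- For every vertex `x` that emits edges, an infinite set is in bijection with the disjoint
union of copies of itself indexed by the edges with source `x`. -/
theorem exists_branching_equiv (x : E.Vertex) (h : Nonempty {f // E.s f = x}) :
    Nonempty ((ℕ ⊕ E.Edge) ≃ {f // E.s f = x} × (ℕ ⊕ E.Edge)) := by
  apply Cardinal.eq.1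
  symm
  rw [← Cardinal.mul_def]
  -- The summand `ℕ` makes the set infinite and `E.Edge` makes it at least as large as any set of
  -- edges, so one set serves all vertices.
  refine Cardinal.mul_eq_right (Cardinal.infinite_iff.1 inferInstance) ?_ ?_
  · exact (Cardinal.mk_subtype_le _).trans (Cardinal.mk_le_of_injective Sum.inr_injective)
  · exact Cardinal.mk_ne_zero _

/-- The points on which the Leavitt path ring acts: each has a vertex and a degree, and, like an
infinite path, a first edge and a tail unless its vertex is a sink. -/
abbrev Point : Type (max v w) := E.Vertex × (ℕ ⊕ E.Edge) × ℤ

variable {E}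

namespace Point

/-- The decomposition of the points at a vertex that emits edges. -/
noncomputable def split (x : E.Vertex) (h : Nonempty {f // E.s f = x}) :
    (ℕ ⊕ E.Edge) ≃ {f // E.s f = x} × (ℕ ⊕ E.Edge) :=
  (exists_branching_equiv E x h).some

open scoped Classical in
/-- The first edge of a point. -/
noncomputable def head (p : Point E) : Option E.Edge :=
  if h : Nonempty {f // E.s f = p.1} then some (split p.1 h p.2.1).1.1 else none

open scoped Classical in
/-- The tail of a point. -/
noncomputable def tail (p : Point E) : Point E :=
  if h : Nonempty {f // E.s f = p.1} then
    (E.r (split p.1 h p.2.1).1.1, (split p.1 h p.2.1).2, p.2.2 - 1)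
  -- A default value at sinks, never seen by `edgeOp`, which tests the head first.
  else p

/-- The point with first edge `f` and tail `p`. -/
noncomputable def cons (f : E.Edge) (p : Point E) : Point E :=
  -- The vertex of `p` is forgotten, so only points at `E.r f` are recovered by `tail`; `ghostOp`
  -- tests for this.
  (E.s f, (split (E.s f) ⟨⟨f, rfl⟩⟩).symm (⟨f, rfl⟩, p.2.1), p.2.2 + 1)

theorem head_cons (f : E.Edge) (p : Point E) : (cons f p).head = some f := by
  have h : Nonempty {g // E.s g = (cons f p).1} := ⟨⟨f, rfl⟩⟩
  rw [head, dif_pos h]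
  exact congrArg (fun q => some q.1.1) ((split (E.s f) h).apply_symm_apply (⟨f, rfl⟩, p.2.1))

theorem tail_cons {f : E.Edge} {p : Point E} (hp : p.1 = E.r f) : (cons f p).tail = p := by
  have h : Nonempty {g // E.s g = (cons f p).1} := ⟨⟨f, rfl⟩⟩
  rw [tail, dif_pos h]
  refine (congrArg (fun q => (E.r q.1.1, q.2, p.2.2 + 1 - 1))
    ((split (E.s f) h).apply_symm_apply (⟨f, rfl⟩, p.2.1))).trans ?_
  rw [add_sub_cancel_right, ← hp]

theorem source_of_head {f : E.Edge} {p : Point E} (h : p.head = some f) : E.s f = p.1 := by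
  unfold head at h
  split_ifs at h with hp
  rw [← Option.some_injective _ h]
  exact (split p.1 hp p.2.1).1.2

theorem tail_fst {f : E.Edge} {p : Point E} (h : p.head = some f) : p.tail.1 = E.r f := by
  unfold head at h
  split_ifs at h with hp
  rw [← Option.some_injective _ h, tail, dif_pos hp]

theorem tail_degree {f : E.Edge} {p : Point E} (h : p.head = some f) :
    p.tail.2.2 = p.2.2 - 1 := by
  unfold head at h
  split_ifs at h with hp
  rw [tail, dif_pos hp]

theorem cons_tail {f : E.Edge} {p : Point E} (h : p.head = some f) : cons f p.tail = p := by
  obtain ⟨x, k, n⟩ := p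
  obtain rfl := source_of_head h
  unfold head at h
  split_ifs at h with hp
  have hf : (split (E.s f) hp k).1 = ⟨f, rfl⟩ := Subtype.ext (Option.some_injective _ h)
  have hk : split (E.s f) hp k = (⟨f, rfl⟩, (split (E.s f) hp k).2) := Prod.ext hf rfl
  rw [tail, dif_pos hp, cons]
  simp only [sub_add_cancel, ← hk, Equiv.symm_apply_apply]

theorem exists_head_eq_some {f : E.Edge} {p : Point E} (h : E.s f = p.1) :
    ∃ g, p.head = some g :=
  ⟨_, dif_pos ⟨⟨f, h⟩⟩⟩

end Point

variable (R : Type u) [Ring R]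

open scoped Classical in
/-- The action of a vertex. -/
noncomputable def vertexOp (x : E.Vertex) : AddMonoid.End (Point E → R) where
  toFun m p := if p.1 = x then m p else 0
  map_zero' := by ext; simp
  map_add' m n := by ext p; by_cases h : p.1 = x <;> simp [h]

open scoped Classical in
/-- The action of an edge. -/
noncomputable def edgeOp (f : E.Edge) : AddMonoid.End (Point E → R) where
  toFun m p := if p.head = some f then m p.tail else 0
  map_zero' := by ext; simp
  map_add' m n := by ext p; by_cases h : p.head = some f <;> simp [h]

open scoped Classical in
/-- The action of a ghost edge. -/
noncomputable def ghostOp (f : E.Edge) : AddMonoid.End (Point E → R) where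
  toFun m p := if p.1 = E.r f then m (Point.cons f p) else 0
  map_zero' := by ext; simp
  map_add' m n := by ext p; by_cases h : p.1 = E.r f <;> simp [h]

open scoped Classical in
theorem vertexOp_apply (x : E.Vertex) (m : Point E → R) (p : Point E) :
    vertexOp R x m p = if p.1 = x then m p else 0 := rfl

open scoped Classical in
theorem edgeOp_apply (f : E.Edge) (m : Point E → R) (p : Point E) :
    edgeOp R f m p = if p.head = some f then m p.tail else 0 := rfl

open scoped Classical in
theorem ghostOp_apply (f : E.Edge) (m : Point E → R) (p : Point E) :
    ghostOp R f m p = if p.1 = E.r f then m (Point.cons f p) else 0 := rfl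

/-- The action of expressions. -/
noncomputable def termAction : Term R E → AddMonoid.End (Point E → R)
  | .vertex x => vertexOp R x
  | .edge f => edgeOp R f
  | .ghost f => ghostOp R f
  | .zero => 0
  | .add a b => termAction a + termAction b
  | .neg a => -termAction a
  | .mul a b => termAction a * termAction b
  -- Both scalar actions multiply values on the left, after or before `a`. Generators only move or
  -- erase values, so they commute with this.
  | .lsmul c a => Module.toAddMonoidEnd R (Point E → R) c * termAction a
  | .rsmul a c => termAction a * Module.toAddMonoidEnd R (Point E → R) c

theorem termAction_sum (l : List (Term R E)) :
    termAction R (Term.sum l) = (l.map (termAction R)).sum := by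
  induction l with
  | nil => rfl
  | cons a l ih => rw [List.map_cons, List.sum_cons, ← ih]; rfl

variable {R}

theorem termAction_eq_of_rel {a b : Term R E} (h : Rel R E a b) : termAction R a = termAction R b := by
  classical
  induction h with
  | add_congr_left _ _ ih | add_congr_right _ _ ih | neg_congr _ ih | mul_congr_left _ _ ih
  | mul_congr_right _ _ ih | lsmul_congr _ _ ih | rsmul_congr _ _ ih => simp only [termAction, ih]
  | add_assoc => simp only [termAction, add_assoc]
  | add_comm => simp only [termAction, add_comm]
  | zero_add => simp only [termAction, zero_add]
  | neg_add_cancel => simp only [termAction, neg_add_cancel]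
  | mul_assoc => simp only [termAction, mul_assoc]
  | left_distrib => simp only [termAction, mul_add]
  | right_distrib => simp only [termAction, add_mul]
  | lsmul_add => simp only [termAction, mul_add]
  | add_lsmul => simp only [termAction, map_add, add_mul]
  | mul_lsmul => simp only [termAction, map_mul, mul_assoc]
  | one_lsmul => simp only [termAction, map_one, one_mul]
  | rsmul_add => simp only [termAction, add_mul]
  | add_rsmul => simp only [termAction, map_add, mul_add]
  | mul_rsmul => simp only [termAction, map_mul, mul_assoc]
  | one_rsmul => simp only [termAction, map_one, mul_one]
  | lsmul_rsmul | mul_rsmul_assoc | lsmul_mul_assoc | rsmul_mul => simp only [termAction, mul_assoc]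
  | vertex_mul_self x =>
    ext m p
    simp only [termAction, AddMonoid.End.coe_mul, Function.comp_apply, vertexOp_apply]
    split_ifs <;> rfl
  | vertex_mul_of_ne x y hxy =>
    ext m p
    simp only [termAction, AddMonoid.End.coe_mul, Function.comp_apply, vertexOp_apply]
    split_ifs with h1 h2
    · exact absurd (h1.symm.trans h2) hxy
    · rfl
    · rfl
  | source_mul_edge f =>
    ext m p
    simp only [termAction, AddMonoid.End.coe_mul, Function.comp_apply, vertexOp_apply, edgeOp_apply]
    split_ifs with h1 h2 h2
    · rfl
    · rfl
    · exact absurd (Point.source_of_head h2).symm h1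
    · rfl
  | edge_mul_range f =>
    ext m p
    simp only [termAction, AddMonoid.End.coe_mul, Function.comp_apply, vertexOp_apply, edgeOp_apply]
    split_ifs with h1 h2
    · rfl
    · exact absurd (Point.tail_fst h1) h2
    · rfl
  | range_mul_ghost f =>
    ext m p
    simp only [termAction, AddMonoid.End.coe_mul, Function.comp_apply, vertexOp_apply, ghostOp_apply]
    split_ifs <;> rfl
  | ghost_mul_source f =>
    ext m p
    simp only [termAction, AddMonoid.End.coe_mul, Function.comp_apply, vertexOp_apply, ghostOp_apply]
    split_ifs with h1 h2
    · rfl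
    · exact absurd rfl h2
    · rfl
  | ghost_mul_edge_self f =>
    ext m p
    simp only [termAction, AddMonoid.End.coe_mul, Function.comp_apply, vertexOp_apply,
      edgeOp_apply, ghostOp_apply]
    split_ifs with h1 h2
    · rw [Point.tail_cons h1]
    · exact absurd (Point.head_cons f p) h2
    · rfl
  | ghost_mul_edge_of_ne f g hfg =>
    ext m p
    simp only [termAction, AddMonoid.End.coe_mul, Function.comp_apply, edgeOp_apply, ghostOp_apply]
    split_ifs with h1 h2
    · exact absurd (Option.some_injective _ ((Point.head_cons f p).symm.trans h2)) hfg
    · rfl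
    · rfl
  | sum_edge_mul_ghost x l hl hnd hmem =>
    -- `f f*` restricts functions to the points with first edge `f`; as `f` runs over the edges
    -- leaving `x`, these sets partition the points at `x`.
    have key : ∀ (f : E.Edge) (m : Point E → R) (p : Point E),
        (edgeOp R f * ghostOp R f) m p = if p.head = some f then m p else 0 := by
      intro f m p
      simp only [AddMonoid.End.coe_mul, Function.comp_apply, edgeOp_apply, ghostOp_apply]
      split_ifs with h1 h2
      · rw [Point.cons_tail h1]
      · exact absurd (Point.tail_fst h1) h2
      · rfl
    rw [termAction_sum, List.map_map, ← List.sum_toFinset _ hnd]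
    ext m p
    refine (congrFun (AddMonoidHom.finsetSum_apply _ _ m) p).trans ?_
    refine (Finset.sum_apply p _ _).trans ?_
    refine (Finset.sum_congr rfl fun f _ => key f m p).trans ?_
    refine Eq.trans ?_ (vertexOp_apply R x m p).symm
    split_ifs with hp
    · obtain ⟨f, hf⟩ := List.exists_mem_of_ne_nil l hl
      obtain ⟨g, hg⟩ := Point.exists_head_eq_some (((hmem f).1 hf).trans hp.symm)
      rw [Finset.sum_eq_single g, if_pos hg]
      · exact fun b _ hb => if_neg fun h => hb (Option.some_injective _ (h.symm.trans hg))
      · exact fun h => absurd (List.mem_toFinset.2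
          ((hmem g).2 ((Point.source_of_head hg).trans hp))) h
    · refine Finset.sum_eq_zero fun f hf => if_neg fun h => hp ?_
      rw [← Point.source_of_head h]
      exact (hmem f).1 (List.mem_toFinset.1 hf)
  | lsmul_vertex c x =>
    ext m p
    change c • vertexOp R x m p = vertexOp R x (c • m) p
    simp only [vertexOp_apply, Pi.smul_apply, smul_ite, smul_zero]
  | lsmul_edge c f =>
    ext m p
    change c • edgeOp R f m p = edgeOp R f (c • m) p
    simp only [edgeOp_apply, Pi.smul_apply, smul_ite, smul_zero]
  | lsmul_ghost c f =>
    ext m p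
    change c • ghostOp R f m p = ghostOp R f (c • m) p
    simp only [ghostOp_apply, Pi.smul_apply, smul_ite, smul_zero]

/-- The action of the Leavitt path ring on the functions on points. -/
noncomputable def eval (x : LeavittPathRing R E) : AddMonoid.End (Point E → R) :=
  Quot.lift (termAction R) (fun _ _ => termAction_eq_of_rel) x

theorem eval_add (x y : LeavittPathRing R E) : eval (x + y) = eval x + eval y := by
  obtain ⟨x⟩ := x
  obtain ⟨y⟩ := y
  rfl

theorem eval_mul (x y : LeavittPathRing R E) : eval (x * y) = eval x * eval y := by
  obtain ⟨x⟩ := x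
  obtain ⟨y⟩ := y
  rfl

theorem eval_smul_apply (c : R) (x : LeavittPathRing R E) (m : Point E → R) :
    eval (c • x) m = c • eval x m := by
  obtain ⟨x⟩ := x
  rfl

/-- The elements that raise degrees by at most `d`. -/
def degreeLE (R : Type u) [Ring R] (E : DirectedGraph.{v, w}) (d : ℤ) :
    Submodule R (LeavittPathRing R E) where
  carrier := {x | ∀ (n : ℤ) (m : Point E → R), (∀ p : Point E, n < p.2.2 → m p = 0) →
    ∀ p : Point E, n + d < p.2.2 → eval x m p = 0}
  zero_mem' _ _ _ _ _ := rfl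
  add_mem' hx hy n m hm p hp := by
    rw [eval_add]
    refine (Pi.add_apply (eval _ m) (eval _ m) p).trans ?_
    rw [ hx n m hm p hp, hy n m hm p hp, add_zero]
  smul_mem' c x hx n m hm p hp := by
    rw [eval_smul_apply, Pi.smul_apply, hx n m hm p hp, smul_zero]

theorem degreeLE_mono : Monotone (degreeLE R E) :=
  fun _ _ hde _ hx n m hm p hp => hx n m hm p (by omega)

theorem mul_mem_degreeLE {x y : LeavittPathRing R E} {d e k : ℤ} (hx : x ∈ degreeLE R E d)
    (hy : y ∈ degreeLE R E e) (hk : d + e ≤ k) : x * y ∈ degreeLE R E k := by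
  intro n m hm p hp
  rw [eval_mul]
  exact hx (n + e) (eval y m) (hy n m hm) p (by omega)

theorem vertex_mem_degreeLE (x : E.Vertex) : vertex R x ∈ degreeLE R E 0 := by
  classical
  intro n m hm p hp
  exact (vertexOp_apply R x m p).trans (by rw [hm p (by omega), ite_self])

theorem edge_mem_degreeLE (f : E.Edge) : edge R f ∈ degreeLE R E 1 := by
  classical
  intro n m hm p hp
  refine (edgeOp_apply R f m p).trans ?_
  split_ifs with h
  · exact hm _ (by rw [Point.tail_degree h]; omega)
  · rfl

theorem ghost_mem_degreeLE (f : E.Edge) : ghost R f ∈ degreeLE R E (-1) := by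
  classical
  intro n m hm p hp
  refine (ghostOp_apply R f m p).trans ?_
  rw [hm _ (by simp only [Point.cons]; omega), ite_self]

theorem eq_zero_of_smul_vertex_mem_degreeLE {c : R} {x : E.Vertex}
    (h : c • vertex R x ∈ degreeLE R E (-1)) : c = 0 := by
  classical
  -- The indicator function of degrees at most 0 is sent by `c x` to a function with value `c` at a
  -- point of degree 0 over `x`.
  have := h 0 (fun p => if 0 < p.2.2 then 0 else 1) (fun p hp => if_pos hp) (x, Sum.inl 0, 0)
    (by norm_num)
  rw [eval_smul_apply, Pi.smul_apply] at this
  change c • vertexOp R x _ _ = 0 at this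
  simpa [vertexOp_apply] using this

theorem eq_zero_of_smul_vertex_eq_zero {c : R} {x : E.Vertex} (h : c • vertex R x = 0) : c = 0 :=
  eq_zero_of_smul_vertex_mem_degreeLE (h ▸ zero_mem _)

end Representation

end LeavittPathRing

/-! ### Annihilators and primeness without a unit -/

namespace TwoSidedIdeal

variable {S : Type u} [NonUnitalRing S]

/-- The left annihilator of a two-sided ideal. -/
def leftAnnihilator (J : TwoSidedIdeal S) : TwoSidedIdeal S :=
  .mk' {a | ∀ b ∈ J, a * b = 0} (fun _ _ => zero_mul _)
    (fun ha hb c hc => by rw [add_mul, ha c hc, hb c hc, add_zero])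
    (fun ha c hc => by rw [neg_mul, ha c hc, neg_zero])
    (fun ha c hc => by rw [mul_assoc, ha c hc, mul_zero])
    (fun {_ y} ha c hc => by rw [mul_assoc, ha _ (J.mul_mem_left y c hc)])

theorem mem_leftAnnihilator {J : TwoSidedIdeal S} {a : S} :
    a ∈ J.leftAnnihilator ↔ ∀ b ∈ J, a * b = 0 :=
  mem_mk' _ _ _ _ _ _ _

theorem exists_mem_ne_zero {J : TwoSidedIdeal S} (h : ¬ J ≤ ⊥) : ∃ x ∈ J, x ≠ 0 := by
  by_contra! h'
  exact h fun x hx => (mem_bot S).2 (h' x hx)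

end TwoSidedIdeal

/-- In a prime ring the elements of a nonzero ideal have no common left annihilator. -/
theorem IsPrimeRing.eq_zero_or_eq_zero {S : Type u} [NonUnitalRing S] (hS : IsPrimeRing S)
    {J : TwoSidedIdeal S} {a b : S} (ha : ∀ x ∈ J, a * x = 0) (hb : b ∈ J) : a = 0 ∨ b = 0 := by
  refine (hS.2 J.leftAnnihilator J fun a ha b hb =>
    (TwoSidedIdeal.mem_bot S).2 (TwoSidedIdeal.mem_leftAnnihilator.1 ha b hb)).imp ?_ ?_
  · exact fun h => (TwoSidedIdeal.mem_bot S).1 (h (TwoSidedIdeal.mem_leftAnnihilator.2 ha))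
  · exact fun h => (TwoSidedIdeal.mem_bot S).1 (h hb)

/-- In a prime ring `aSb = 0` implies `a = 0` or `b = 0`, if `a ∈ aS` and `b ∈ Sb`. -/
theorem IsPrimeRing.eq_zero_or_eq_zero_of_mul_mul {S : Type u} [NonUnitalRing S]
    (hS : IsPrimeRing S) {a b e : S} (ha : a * e = a) (h : ∀ x, a * (x * b) = 0) :
    a = 0 ∨ b = 0 := by
  -- The first condition follows from the second; carrying it makes closure under right
  -- multiplication immediate.
  let J : TwoSidedIdeal S := .mk' {b | ∀ x y, a * (x * (b * y)) = 0 ∧ a * (x * b) = 0}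
    (fun x y => by simp)
    (fun hb hc x y => by
      simp only [add_mul, mul_add, (hb x y).1, (hc x y).1, (hb x y).2, (hc x y).2, add_zero,
        and_self])
    (fun hb x y => by
      simp only [neg_mul, mul_neg, (hb x y).1, (hb x y).2, neg_zero, and_self])
    (fun {z b} hb x y => by
      have := hb (x * z) y
      simpa only [mul_assoc] using this)
    (fun {b z} hb x y => by
      rw [mul_assoc]
      exact ⟨(hb x (z * y)).1, (hb x z).1⟩)
  refine hS.eq_zero_or_eq_zero (J := J) (fun x hx => ?_) ?_
  · rw [← ha, mul_assoc]
    exact (((TwoSidedIdeal.mem_mk' _ _ _ _ _ _ _).1 hx) e 0).2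
  · refine (TwoSidedIdeal.mem_mk' _ _ _ _ _ _ _).2 fun x y => ⟨?_, h x⟩
    rw [← mul_assoc x, ← mul_assoc, h, zero_mul]

/-- This unfolds one level of the recursively defined spans below, with `φ` multiplication by an
edge or a ghost edge. -/
theorem Submodule.exists_eq_add_sum_of_mem_sup_iSup_map {R M ι : Type*} [Ring R] [AddCommGroup M]
    [Module R M] {S T : Submodule R M} {φ : ι → M →ₗ[R] M} {x : M}
    (hx : x ∈ S ⊔ ⨆ i, T.map (φ i)) :
    ∃ y ∈ S, ∃ (F : Finset ι) (g : ι → M), (∀ i, g i ∈ T) ∧ x = y + ∑ i ∈ F, φ i (g i) := by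
  obtain ⟨y, hy, z, hz, rfl⟩ := Submodule.mem_sup.1 hx
  obtain ⟨h, hh, rfl⟩ := (Submodule.mem_iSup_iff_exists_finsupp _ _).1 hz
  choose g hg hg' using hh
  refine ⟨y, hy, h.support, g, hg, ?_⟩
  simp only [hg']
  rfl

namespace LeavittPathRing

/-! ### Spans of paths and of monomials -/

section Spans

variable (R : Type u) [Ring R] {E : DirectedGraph.{v, w}}

/-- Left multiplication by an edge. -/
def edgeMul (f : E.Edge) : LeavittPathRing R E →ₗ[R] LeavittPathRing R E where
  toFun x := edge R f * x
  map_add' := mul_add _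
  map_smul' c x := edge_mul_smul f c x

/-- Right multiplication by a ghost edge. -/
def mulGhost (f : E.Edge) : LeavittPathRing R E →ₗ[R] LeavittPathRing R E where
  toFun x := x * ghost R f
  map_add' x y := add_mul x y _
  map_smul' c x := smul_mul_assoc c x _

variable (E)

/-- The span of the paths of length at most `d`. -/
def pathSpan : ℕ → Submodule R (LeavittPathRing R E)
  | 0 => Submodule.span R (Set.range (vertex R))
  | d + 1 => Submodule.span R (Set.range (vertex R)) ⊔ ⨆ f, (pathSpan d).map (edgeMul R f)

/-- The span of the monomials `p q*` where `p` and `q` are paths and the length of `q` is at most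
`n`. -/
def monomialSpan : ℕ → Submodule R (LeavittPathRing R E)
  | 0 => ⨆ d, pathSpan R E d
  | n + 1 => (⨆ d, pathSpan R E d) ⊔ ⨆ f, (monomialSpan n).map (mulGhost R f)

variable {R E}

theorem vertex_mem_pathSpan (x : E.Vertex) : ∀ d, vertex R x ∈ pathSpan R E d
  | 0 => Submodule.subset_span ⟨x, rfl⟩
  | _ + 1 => Submodule.mem_sup_left (Submodule.subset_span ⟨x, rfl⟩)

theorem edge_mul_mem_pathSpan (f : E.Edge) {d : ℕ} {x : LeavittPathRing R E}
    (hx : x ∈ pathSpan R E d) : edge R f * x ∈ pathSpan R E (d + 1) :=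
  Submodule.mem_sup_right (Submodule.mem_iSup_of_mem f ⟨x, hx, rfl⟩)

@[elab_as_elim]
theorem pathSpan_induction {p : ∀ d (x : LeavittPathRing R E), x ∈ pathSpan R E d → Prop}
    (vertex : ∀ d x, p d (vertex R x) (vertex_mem_pathSpan x d))
    (edge_mul : ∀ d f x hx, p d x hx → p (d + 1) (edge R f * x) (edge_mul_mem_pathSpan f hx))
    (zero : ∀ d, p d 0 (zero_mem _))
    (add : ∀ d x y hx hy, p d x hx → p d y hy → p d (x + y) (add_mem hx hy))
    (smul : ∀ d (c : R) x hx, p d x hx → p d (c • x) (Submodule.smul_mem _ c hx)) {d : ℕ}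
    {x : LeavittPathRing R E} (hx : x ∈ pathSpan R E d) : p d x hx := by
  let T (d : ℕ) : Submodule R (LeavittPathRing R E) :=
    { carrier := {x | ∃ hx, p d x hx}
      zero_mem' := ⟨_, zero d⟩
      add_mem' := fun ⟨_, hx⟩ ⟨_, hy⟩ => ⟨_, add d _ _ _ _ hx hy⟩
      smul_mem' := fun c _ ⟨_, hx⟩ => ⟨_, smul d c _ _ hx⟩ }
  suffices h : pathSpan R E d ≤ T d from (h hx).2
  clear hx x
  induction d with
  | zero => exact Submodule.span_le.2 (by rintro _ ⟨x, rfl⟩; exact ⟨_, vertex 0 x⟩)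
  | succ d ih =>
    refine sup_le (Submodule.span_le.2 (by rintro _ ⟨x, rfl⟩; exact ⟨_, vertex _ x⟩))
      (iSup_le fun f => ?_)
    rintro _ ⟨x, hx, rfl⟩
    exact ⟨_, edge_mul d f x _ (ih hx).2⟩

theorem pathSpan_mono : Monotone (pathSpan R E) := by
  refine monotone_nat_of_le_succ fun d x hx => ?_
  induction hx using pathSpan_induction with
  | vertex d x => exact vertex_mem_pathSpan x _
  | edge_mul d f x _ hx => exact edge_mul_mem_pathSpan f hx
  | zero d => exact zero_mem _
  | add d x y _ _ hx hy => exact add_mem hx hy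
  | smul d c x _ hx => exact Submodule.smul_mem _ c hx

theorem mem_iSup_pathSpan {x : LeavittPathRing R E} :
    x ∈ ⨆ d, pathSpan R E d ↔ ∃ d, x ∈ pathSpan R E d :=
  Submodule.mem_iSup_of_directed _ pathSpan_mono.directed_le

theorem pathSpan_mul_vertex_mem {d : ℕ} {x : LeavittPathRing R E} (hx : x ∈ pathSpan R E d)
    (y : E.Vertex) : x * vertex R y ∈ pathSpan R E d := by
  induction hx using pathSpan_induction with
  | vertex d x =>
    obtain rfl | h := eq_or_ne x y
    · rw [vertex_mul_vertex_self]; exact vertex_mem_pathSpan x d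
    · rw [vertex_mul_vertex_of_ne h]; exact zero_mem _
  | edge_mul d f x _ hx => rw [mul_assoc]; exact edge_mul_mem_pathSpan f hx
  | zero d => rw [zero_mul]; exact zero_mem _
  | add d x y _ _ hx hy => rw [add_mul]; exact add_mem hx hy
  | smul d c x _ hx => rw [smul_mul_assoc]; exact Submodule.smul_mem _ c hx

theorem vertex_mul_mem_pathSpan {d : ℕ} {x : LeavittPathRing R E} (hx : x ∈ pathSpan R E d)
    (y : E.Vertex) : vertex R y * x ∈ pathSpan R E d := by
  induction hx using pathSpan_induction with
  | vertex d x =>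
    obtain rfl | h := eq_or_ne y x
    · rw [vertex_mul_vertex_self]; exact vertex_mem_pathSpan y d
    · rw [vertex_mul_vertex_of_ne h]; exact zero_mem _
  | edge_mul d f x hx _ =>
    rw [← mul_assoc]
    obtain rfl | h := eq_or_ne y (E.s f)
    · rw [vertex_source_mul_edge]; exact edge_mul_mem_pathSpan f hx
    · rw [vertex_mul_edge_of_ne h, zero_mul]; exact zero_mem _
  | zero d => rw [mul_zero]; exact zero_mem _
  | add d x y _ _ hx hy => rw [mul_add]; exact add_mem hx hy
  | smul d c x _ hx => rw [vertex_mul_smul]; exact Submodule.smul_mem _ c hx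

theorem pathSpan_mul_edge_mem {d : ℕ} {x : LeavittPathRing R E} (hx : x ∈ pathSpan R E d)
    (g : E.Edge) : x * edge R g ∈ pathSpan R E (d + 1) := by
  induction hx using pathSpan_induction with
  | vertex d x =>
    obtain rfl | h := eq_or_ne x (E.s g)
    · rw [vertex_source_mul_edge, ← edge_mul_vertex_range]
      exact edge_mul_mem_pathSpan g (vertex_mem_pathSpan _ d)
    · rw [vertex_mul_edge_of_ne h]; exact zero_mem _
  | edge_mul d f x _ hx => rw [mul_assoc]; exact edge_mul_mem_pathSpan f hx
  | zero d => rw [zero_mul]; exact zero_mem _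
  | add d x y _ _ hx hy => rw [add_mul]; exact add_mem hx hy
  | smul d c x _ hx => rw [smul_mul_assoc]; exact Submodule.smul_mem _ c hx

theorem pathSpan_op_smul_mem {d : ℕ} {x : LeavittPathRing R E} (hx : x ∈ pathSpan R E d)
    (c : R) : MulOpposite.op c • x ∈ pathSpan R E d := by
  induction hx using pathSpan_induction with
  | vertex d x => rw [op_smul_vertex]; exact Submodule.smul_mem _ c (vertex_mem_pathSpan x d)
  | edge_mul d f x _ hx => rw [← mul_op_smul]; exact edge_mul_mem_pathSpan f hx
  | zero d => rw [smul_zero]; exact zero_mem _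
  | add d x y _ _ hx hy => rw [smul_add]; exact add_mem hx hy
  | smul d a x _ hx => rw [← smul_comm]; exact Submodule.smul_mem _ a hx

theorem mem_monomialSpan_of_mem_pathSpan {d : ℕ} {x : LeavittPathRing R E}
    (hx : x ∈ pathSpan R E d) : ∀ n, x ∈ monomialSpan R E n
  | 0 => mem_iSup_pathSpan.2 ⟨d, hx⟩
  | _ + 1 => Submodule.mem_sup_left (mem_iSup_pathSpan.2 ⟨d, hx⟩)

theorem mul_ghost_mem_monomialSpan (f : E.Edge) {n : ℕ} {x : LeavittPathRing R E}
    (hx : x ∈ monomialSpan R E n) : x * ghost R f ∈ monomialSpan R E (n + 1) :=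
  Submodule.mem_sup_right (Submodule.mem_iSup_of_mem f ⟨x, hx, rfl⟩)

@[elab_as_elim]
theorem monomialSpan_induction
    {p : ∀ n (x : LeavittPathRing R E), x ∈ monomialSpan R E n → Prop}
    (path : ∀ n d x (hx : x ∈ pathSpan R E d), p n x (mem_monomialSpan_of_mem_pathSpan hx n))
    (mul_ghost : ∀ n f x hx, p n x hx → p (n + 1) (x * ghost R f) (mul_ghost_mem_monomialSpan f hx))
    (add : ∀ n x y hx hy, p n x hx → p n y hy → p n (x + y) (add_mem hx hy))
    (smul : ∀ n (c : R) x hx, p n x hx → p n (c • x) (Submodule.smul_mem _ c hx)) {n : ℕ}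
    {x : LeavittPathRing R E} (hx : x ∈ monomialSpan R E n) : p n x hx := by
  let T (n : ℕ) : Submodule R (LeavittPathRing R E) :=
    { carrier := {x | ∃ hx, p n x hx}
      zero_mem' := ⟨_, path n 0 0 (zero_mem _)⟩
      add_mem' := fun ⟨_, hx⟩ ⟨_, hy⟩ => ⟨_, add n _ _ _ _ hx hy⟩
      smul_mem' := fun c _ ⟨_, hx⟩ => ⟨_, smul n c _ _ hx⟩ }
  suffices h : monomialSpan R E n ≤ T n from (h hx).2
  clear hx x
  induction n with
  | zero => exact iSup_le fun d x hx => ⟨_, path 0 d x hx⟩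
  | succ n ih =>
    refine sup_le (iSup_le fun d x hx => ⟨_, path _ d x hx⟩) (iSup_le fun f => ?_)
    rintro _ ⟨x, hx, rfl⟩
    exact ⟨_, mul_ghost n f x _ (ih hx).2⟩

theorem monomialSpan_mono : Monotone (monomialSpan R E) := by
  refine monotone_nat_of_le_succ fun d x hx => ?_
  induction hx using monomialSpan_induction with
  | path n d x hx => exact mem_monomialSpan_of_mem_pathSpan hx _
  | mul_ghost n f x _ hx => exact mul_ghost_mem_monomialSpan f hx
  | add n x y _ _ hx hy => exact add_mem hx hy
  | smul n c x _ hx => exact Submodule.smul_mem _ c hx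

theorem monomialSpan_mul_vertex_mem {n : ℕ} {x : LeavittPathRing R E}
    (hx : x ∈ monomialSpan R E n) (y : E.Vertex) : x * vertex R y ∈ monomialSpan R E n := by
  induction hx using monomialSpan_induction with
  | path n d x hx => exact mem_monomialSpan_of_mem_pathSpan (pathSpan_mul_vertex_mem hx y) n
  | mul_ghost n f x hx _ =>
    rw [mul_assoc]
    obtain rfl | h := eq_or_ne (E.s f) y
    · rw [ghost_mul_vertex_source]; exact mul_ghost_mem_monomialSpan f hx
    · rw [ghost_mul_vertex_of_ne h, mul_zero]; exact zero_mem _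
  | add n x y _ _ hx hy => rw [add_mul]; exact add_mem hx hy
  | smul n c x _ hx => rw [smul_mul_assoc]; exact Submodule.smul_mem _ c hx

/-- A last ghost edge cancels against `g` or is killed by it. The truncated `n - 1` is harmless:
level 0 consists of paths, which `g` merely extends. -/
theorem monomialSpan_mul_edge_mem {n : ℕ} {x : LeavittPathRing R E}
    (hx : x ∈ monomialSpan R E n) (g : E.Edge) : x * edge R g ∈ monomialSpan R E (n - 1) := by
  induction hx using monomialSpan_induction with
  | path n d x hx => exact mem_monomialSpan_of_mem_pathSpan (pathSpan_mul_edge_mem hx g) _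
  | mul_ghost n f x hx _ =>
    rw [mul_assoc]
    obtain rfl | h := eq_or_ne f g
    · rw [ghost_mul_edge_self]; exact monomialSpan_mul_vertex_mem hx _
    · rw [ghost_mul_edge_of_ne h, mul_zero]; exact zero_mem _
  | add n x y _ _ hx hy => rw [add_mul]; exact add_mem hx hy
  | smul n c x _ hx => rw [smul_mul_assoc]; exact Submodule.smul_mem _ c hx

theorem monomialSpan_op_smul_mem {n : ℕ} {x : LeavittPathRing R E}
    (hx : x ∈ monomialSpan R E n) (c : R) : MulOpposite.op c • x ∈ monomialSpan R E n := by
  induction hx using monomialSpan_induction with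
  | path n d x hx => exact mem_monomialSpan_of_mem_pathSpan (pathSpan_op_smul_mem hx c) n
  | mul_ghost n f x _ hx =>
    rw [← mul_op_smul, op_smul_ghost, ← op_smul_mul]
    exact mul_ghost_mem_monomialSpan f hx
  | add n x y _ _ hx hy => rw [smul_add]; exact add_mem hx hy
  | smul n a x _ hx => rw [← smul_comm]; exact Submodule.smul_mem _ a hx

theorem exists_mem_monomialSpan (x : LeavittPathRing R E) : ∃ n, x ∈ monomialSpan R E n := by
  -- Products and left scalars require the stronger claim that right multiplication by `x` preserves
  -- the union of the spans.
  suffices h : (∃ n, x ∈ monomialSpan R E n) ∧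
      ∀ n, ∀ a ∈ monomialSpan R E n, ∃ m, a * x ∈ monomialSpan R E m from h.1
  induction x using generator_induction with
  | vertex y =>
    exact ⟨⟨0, mem_monomialSpan_of_mem_pathSpan (vertex_mem_pathSpan y 0) 0⟩,
      fun n a ha => ⟨n, monomialSpan_mul_vertex_mem ha y⟩⟩
  | edge f =>
    refine ⟨⟨0, mem_monomialSpan_of_mem_pathSpan (d := 1) ?_ 0⟩,
      fun n a ha => ⟨_, monomialSpan_mul_edge_mem ha f⟩⟩
    rw [← edge_mul_vertex_range]
    exact edge_mul_mem_pathSpan f (vertex_mem_pathSpan _ 0)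
  | ghost f =>
    refine ⟨⟨1, ?_⟩, fun n a ha => ⟨_, mul_ghost_mem_monomialSpan f ha⟩⟩
    rw [← vertex_range_mul_ghost]
    exact mul_ghost_mem_monomialSpan f
      (mem_monomialSpan_of_mem_pathSpan (vertex_mem_pathSpan (E.r f) 0) 0)
  | zero => exact ⟨⟨0, zero_mem _⟩, fun n a ha => ⟨0, by rw [mul_zero]; exact zero_mem _⟩⟩
  | add x y hx hy =>
    obtain ⟨⟨i, hi⟩, hx⟩ := hx
    obtain ⟨⟨j, hj⟩, hy⟩ := hy
    refine ⟨⟨max i j, add_mem (monomialSpan_mono (le_max_left i j) hi)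
      (monomialSpan_mono (le_max_right i j) hj)⟩, fun n a ha => ?_⟩
    obtain ⟨i, hi⟩ := hx n a ha
    obtain ⟨j, hj⟩ := hy n a ha
    rw [mul_add]
    exact ⟨max i j, add_mem (monomialSpan_mono (le_max_left i j) hi)
      (monomialSpan_mono (le_max_right i j) hj)⟩
  | neg x hx =>
    obtain ⟨⟨i, hi⟩, hx⟩ := hx
    refine ⟨⟨i, neg_mem hi⟩, fun n a ha => ?_⟩
    obtain ⟨m, hm⟩ := hx n a ha
    exact ⟨m, by rw [mul_neg]; exact neg_mem hm⟩
  | mul x y hx hy =>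
    obtain ⟨⟨i, hi⟩, hx⟩ := hx
    refine ⟨hy.2 i x hi, fun n a ha => ?_⟩
    obtain ⟨m, hm⟩ := hx n a ha
    rw [← mul_assoc]
    exact hy.2 m _ hm
  | smul c x hx =>
    obtain ⟨⟨i, hi⟩, hx⟩ := hx
    refine ⟨⟨i, Submodule.smul_mem _ c hi⟩, fun n a ha => ?_⟩
    rw [← op_smul_mul]
    exact hx n _ (monomialSpan_op_smul_mem ha c)
  | op_smul c x hx =>
    obtain ⟨⟨i, hi⟩, hx⟩ := hx
    refine ⟨⟨i, monomialSpan_op_smul_mem hi c⟩, fun n a ha => ?_⟩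
    obtain ⟨m, hm⟩ := hx n a ha
    rw [mul_op_smul]
    exact ⟨m, monomialSpan_op_smul_mem hm c⟩

end Spans

/-! ### From a nonzero ideal to a vertex plus lower degree, and sufficiency -/

section Reduction

variable {R : Type u} [Ring R] {E : DirectedGraph.{v, w}}

theorem exists_smul_vertex_of_mem_span {y : LeavittPathRing R E}
    (hy : y ∈ Submodule.span R (Set.range (vertex R))) (x : E.Vertex) :
    vertex R x * y = y * vertex R x ∧ ∃ c : R, vertex R x * y = c • vertex R x := by
  induction hy using Submodule.span_induction with
  | mem y hy =>
    obtain ⟨z, rfl⟩ := hy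
    obtain rfl | h := eq_or_ne x z
    · exact ⟨rfl, 1, by rw [vertex_mul_vertex_self, one_smul]⟩
    · rw [vertex_mul_vertex_of_ne h, vertex_mul_vertex_of_ne h.symm]
      exact ⟨rfl, 0, (zero_smul _ _).symm⟩
  | zero => exact ⟨by simp, 0, by simp⟩
  | add y z _ _ hy hz =>
    obtain ⟨hy, a, ha⟩ := hy
    obtain ⟨hz, b, hb⟩ := hz
    exact ⟨by rw [mul_add, add_mul, hy, hz], a + b, by rw [mul_add, ha, hb, add_smul]⟩
  | smul c y _ hy =>
    obtain ⟨hy, a, ha⟩ := hy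
    exact ⟨by rw [vertex_mul_smul, smul_mul_assoc, hy], c * a, by
      rw [vertex_mul_smul, ha, mul_smul]⟩

theorem exists_vertex_mul_eq_of_mem_span {y n : LeavittPathRing R E}
    (hy : y ∈ Submodule.span R (Set.range (vertex R))) (hy0 : y ≠ 0)
    (hn : n ∈ degreeLE R E (-1)) :
    ∃ (b : LeavittPathRing R E) (c : R) (x : E.Vertex), c ≠ 0 ∧
      ∃ n' ∈ degreeLE R E (-1), b * (y + n) = c • vertex R x + n' := by
  obtain ⟨x, hx⟩ := exists_mul_vertex_ne_zero hy0
  obtain ⟨h, c, hc⟩ := exists_smul_vertex_of_mem_span hy x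
  refine ⟨vertex R x, c, x, ?_, vertex R x * n,
    mul_mem_degreeLE (vertex_mem_degreeLE x) hn (by norm_num), by rw [mul_add, hc]⟩
  rintro rfl
  rw [zero_smul, h] at hc
  exact hx hc

theorem span_vertex_le_degreeLE :
    Submodule.span R (Set.range (vertex R)) ≤ degreeLE R E 0 :=
  Submodule.span_le.2 (by rintro _ ⟨x, rfl⟩; exact vertex_mem_degreeLE x)

/-- A ghost edge `f*` selects the part of `y` that starts with `f` and shortens it. If no such part
survives, `y` is a combination of vertices. The error term `n` is there for the induction. -/
theorem exists_mul_eq_smul_vertex_add {d : ℕ} {y n : LeavittPathRing R E}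
    (hy : y ∈ pathSpan R E d) (hy0 : y ≠ 0) (hn : n ∈ degreeLE R E (-1)) :
    ∃ (b : LeavittPathRing R E) (c : R) (x : E.Vertex), c ≠ 0 ∧
      ∃ n' ∈ degreeLE R E (-1), b * (y + n) = c • vertex R x + n' := by
  induction d generalizing y n with
  | zero => exact exists_vertex_mul_eq_of_mem_span hy hy0 hn
  | succ d ih =>
    obtain ⟨z, hz, F, g, hg, rfl⟩ := Submodule.exists_eq_add_sum_of_mem_sup_iSup_map hy
    simp only [edgeMul, LinearMap.coe_mk, AddHom.coe_mk] at hy0 ⊢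
    by_cases h : ∃ f ∈ F, vertex R (E.r f) * g f ≠ 0
    · obtain ⟨f, hf, hfg⟩ := h
      have hsum : ghost R f * ∑ i ∈ F, edge R i * g i = vertex R (E.r f) * g f := by
        rw [Finset.mul_sum, Finset.sum_eq_single_of_mem f hf, ← mul_assoc, ghost_mul_edge_self]
        intro i _ hi
        rw [← mul_assoc, ghost_mul_edge_of_ne hi.symm, zero_mul]
      -- Under `f*` the vertices in `z` drop to degree −1 and join the error term.
      have hfz : ghost R f * (z + n) ∈ degreeLE R E (-1) := by
        rw [mul_add]
        exact add_mem (mul_mem_degreeLE (ghost_mem_degreeLE f) (span_vertex_le_degreeLE hz)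
          (by norm_num)) (mul_mem_degreeLE (ghost_mem_degreeLE f) hn (by norm_num))
      obtain ⟨b, c, x, hc, n', hn', h⟩ := ih (vertex_mul_mem_pathSpan (hg f) _) hfg hfz
      refine ⟨b * ghost R f, c, x, hc, n', hn', ?_⟩
      rw [← h, mul_assoc, add_right_comm, mul_add (ghost R f), hsum, add_comm]
    · push Not at h
      have hsum : ∑ i ∈ F, edge R i * g i = 0 := Finset.sum_eq_zero fun i hi => by
        rw [← edge_mul_vertex_range, mul_assoc, h i hi, mul_zero]
      rw [hsum, add_zero] at hy0 ⊢
      exact exists_vertex_mul_eq_of_mem_span hz hy0 hn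

/-- Otherwise some `b` takes `y s(g)` to `c x + n` with `c ≠ 0` and `n` of negative degree. If `x =
s(g)`, then `g* _ g` gives `c r(g) = -g* n g`; if not, right multiplication by `s(g)` fixes `c x +
n` but kills `c x`. Either way a nonzero multiple of a vertex has negative degree. -/
theorem mul_vertex_source_eq_zero {d : ℕ} {y : LeavittPathRing R E} (hy : y ∈ pathSpan R E d)
    {g : E.Edge} (h : y * edge R g = 0) : y * vertex R (E.s g) = 0 := by
  by_contra h0
  obtain ⟨b, c, x, hc, n, hn, hb⟩ :=
    exists_mul_eq_smul_vertex_add (pathSpan_mul_vertex_mem hy (E.s g)) h0 (zero_mem _)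
  rw [add_zero] at hb
  apply hc
  obtain rfl | hx := eq_or_ne x (E.s g)
  · have h1 : c • edge R g + n * edge R g = 0 := by
      rw [← vertex_source_mul_edge, ← smul_mul_assoc, vertex_source_mul_edge, ← add_mul, ← hb,
        mul_assoc, mul_assoc, vertex_source_mul_edge, h, mul_zero]
    have h2 : c • vertex R (E.r g) = -(ghost R g * (n * edge R g)) := by
      rw [← ghost_mul_edge_self, ← ghost_mul_smul, eq_neg_of_add_eq_zero_left h1, mul_neg]
    apply eq_zero_of_smul_vertex_mem_degreeLE (x := E.r g)
    rw [h2]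
    exact neg_mem (mul_mem_degreeLE (ghost_mem_degreeLE g)
      (mul_mem_degreeLE hn (edge_mem_degreeLE g) le_rfl) (by norm_num))
  · have h1 : (c • vertex R x + n) * vertex R (E.s g) = c • vertex R x + n := by
      rw [← hb, mul_assoc, mul_assoc, vertex_mul_vertex_self]
    rw [add_mul, smul_mul_assoc, vertex_mul_vertex_of_ne hx, smul_zero, zero_add] at h1
    apply eq_zero_of_smul_vertex_mem_degreeLE (x := x)
    rw [eq_sub_of_add_eq h1.symm]
    exact sub_mem (mul_mem_degreeLE hn (vertex_mem_degreeLE _) (by norm_num)) hn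

/-- As long as some `x f` is nonzero, it has shorter ghost parts. When all vanish, take `v` with `x
v ≠ 0` and write `x = p + ∑ g_f f*` over a finite set `F`: relation (v) or an edge outside `F`
contradicts `x v ≠ 0`, unless `v` is a sink and `x v = p v`. -/
theorem exists_mem_pathSpan_of_mem_ideal {n : ℕ} {x : LeavittPathRing R E}
    (hx : x ∈ monomialSpan R E n) (hx0 : x ≠ 0) {A : TwoSidedIdeal (LeavittPathRing R E)}
    (hA : x ∈ A) : ∃ y ∈ A, y ≠ 0 ∧ ∃ d, y ∈ pathSpan R E d := by
  classical
  induction n generalizing x with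
  | zero => exact ⟨x, hA, hx0, mem_iSup_pathSpan.1 hx⟩
  | succ n ih =>
    by_cases h : ∃ f, x * edge R f ≠ 0
    · obtain ⟨f, hf⟩ := h
      exact ih (monomialSpan_mul_edge_mem hx f) hf (A.mul_mem_right _ _ hA)
    push Not at h
    obtain ⟨v, hv⟩ := exists_mul_vertex_ne_zero hx0
    obtain ⟨p, hp, F, g, -, hxF⟩ := Submodule.exists_eq_add_sum_of_mem_sup_iSup_map hx
    obtain ⟨d, hp⟩ := mem_iSup_pathSpan.1 hp
    simp only [mulGhost, LinearMap.coe_mk, AddHom.coe_mk] at hxF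
    by_cases hreg : ∀ k, E.s k = v → k ∈ F
    · by_cases hne : ∃ k, E.s k = v
      · refine absurd ?_ hv
        obtain ⟨k, hk⟩ := hne
        rw [← sum_edge_mul_ghost (F := F.filter fun f => E.s f = v)
          ⟨k, Finset.mem_filter.2 ⟨hreg k hk, hk⟩⟩
          (fun f => Finset.mem_filter.trans (and_iff_right_of_imp (hreg f))), Finset.mul_sum]
        exact Finset.sum_eq_zero fun f _ => by rw [← mul_assoc, h, zero_mul]
      · push Not at hne
        refine ⟨x * vertex R v, A.mul_mem_right _ _ hA, hv, d, ?_⟩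
        rw [hxF, add_mul, Finset.sum_mul, Finset.sum_eq_zero, add_zero]
        · exact pathSpan_mul_vertex_mem hp v
        · exact fun f _ => by rw [mul_assoc, ghost_mul_vertex_of_ne (hne f), mul_zero]
    · push Not at hreg
      -- For `k` outside `F`, `x k = p k`, so `p v = 0`. Then `x f = 0` reads `g_f r(f) = 0` for
      -- each `f ∈ F` leaving `v`, whence `x v = 0`.
      obtain ⟨k, rfl, hk⟩ := hreg
      have hedge (f : E.Edge) :
          x * edge R f = p * edge R f + if f ∈ F then g f * vertex R (E.r f) else 0 := by
        rw [hxF, add_mul, Finset.sum_mul]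
        congr 1
        rw [← Finset.sum_ite_eq' F f (fun i => g i * vertex R (E.r i))]
        refine Finset.sum_congr rfl fun i _ => ?_
        rw [mul_assoc]
        split_ifs with hi
        · rw [hi, ghost_mul_edge_self]
        · rw [ghost_mul_edge_of_ne hi, mul_zero]
      have hpk : p * vertex R (E.s k) = 0 := by
        refine mul_vertex_source_eq_zero hp ?_
        rw [← h k, hedge, if_neg hk, add_zero]
      refine absurd ?_ hv
      rw [hxF, add_mul, hpk, zero_add, Finset.sum_mul]
      refine Finset.sum_eq_zero fun f hf => ?_
      by_cases hfk : E.s f = E.s k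
      · have := h f
        rw [hedge, if_pos hf, ← vertex_source_mul_edge, ← mul_assoc p, hfk, hpk, zero_mul,
          zero_add] at this
        rw [← vertex_range_mul_ghost, ← mul_assoc (g f), this, zero_mul, zero_mul]
      · rw [mul_assoc, ghost_mul_vertex_of_ne hfk, mul_zero]

theorem exists_smul_vertex_add_mem_ideal {A : TwoSidedIdeal (LeavittPathRing R E)}
    (hA : ¬ A ≤ ⊥) :
    ∃ (c : R) (x : E.Vertex), c ≠ 0 ∧ ∃ n ∈ degreeLE R E (-1), c • vertex R x + n ∈ A := by
  obtain ⟨a, ha, ha0⟩ := TwoSidedIdeal.exists_mem_ne_zero hA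
  obtain ⟨m, hm⟩ := exists_mem_monomialSpan a
  obtain ⟨y, hy, hy0, d, hd⟩ := exists_mem_pathSpan_of_mem_ideal hm ha0 ha
  obtain ⟨b, c, x, hc, n, hn, h⟩ := exists_mul_eq_smul_vertex_add hd hy0 (zero_mem _)
  rw [add_zero] at h
  exact ⟨c, x, hc, n, hn, h ▸ A.mul_mem_left _ _ hy⟩

/-- For an edge, `f* (c s(f) + n) f = c r(f) + f* n f`, and the degrees of `f*` and `f` cancel. -/
theorem smul_vertex_add_mem_ideal_of_reaches {A : TwoSidedIdeal (LeavittPathRing R E)} {c : R}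
    {x y : E.Vertex} (hxy : E.Reaches x y) {n : LeavittPathRing R E}
    (hn : n ∈ degreeLE R E (-1)) (h : c • vertex R x + n ∈ A) :
    ∃ n' ∈ degreeLE R E (-1), c • vertex R y + n' ∈ A := by
  obtain ⟨l, hl⟩ := hxy
  induction l generalizing x n with
  | nil =>
    obtain rfl : x = y := hl
    exact ⟨n, hn, h⟩
  | cons f l ih =>
    obtain ⟨rfl, hl⟩ := hl
    refine ih (n := ghost R f * (n * edge R f)) (mul_mem_degreeLE (ghost_mem_degreeLE f)
      (mul_mem_degreeLE hn (edge_mem_degreeLE f) le_rfl) (by norm_num)) ?_ hl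
    have := A.mul_mem_left (ghost R f) _ (A.mul_mem_right _ (edge R f) h)
    rwa [add_mul, smul_mul_assoc, vertex_source_mul_edge, mul_add, ghost_mul_smul,
      ghost_mul_edge_self] at this

theorem isPrimeRing_of_MT3 [Nonempty E.Vertex] (hR : IsPrimeRing R) (hE : E.MT3) :
    IsPrimeRing (LeavittPathRing R E) := by
  refine ⟨fun htop => ?_, fun A B hAB => ?_⟩
  · obtain ⟨x⟩ := ‹Nonempty E.Vertex›
    have h1 : (1 : R) = 0 := by
      apply eq_zero_of_smul_vertex_eq_zero (x := x)
      rw [← TwoSidedIdeal.mem_bot, htop]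
      exact TwoSidedIdeal.mem_top _
    refine hR.1 (top_unique fun a _ => (TwoSidedIdeal.mem_bot R).2 ?_)
    rw [← mul_one a, h1, mul_zero]
  · by_contra! hne
    obtain ⟨a, x, ha, n, hn, haA⟩ := exists_smul_vertex_add_mem_ideal hne.1
    obtain ⟨b, y, hb, m, hm, hbB⟩ := exists_smul_vertex_add_mem_ideal hne.2
    obtain ⟨z, hxz, hyz⟩ := hE x y
    obtain ⟨n, hn, haA⟩ := smul_vertex_add_mem_ideal_of_reaches hxz hn haA
    obtain ⟨m, hm, hbB⟩ := smul_vertex_add_mem_ideal_of_reaches hyz hm hbB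
    refine (hR.eq_zero_or_eq_zero_of_mul_mul (mul_one a) fun s => ?_).elim ha hb
    have hz (c : R) : c • vertex R z ∈ degreeLE R E 0 :=
      Submodule.smul_mem _ c (vertex_mem_degreeLE z)
    have h0 := (TwoSidedIdeal.mem_bot _).1 (hAB _ haA _ (B.mul_mem_left (s • vertex R z) _ hbB))
    -- Every other term of the vanishing product contains `n` or `m`, hence has degree at most −1.
    have h1 : (a * (s * b)) • vertex R z = -(a • vertex R z * (s • vertex R z * m) +
        n * (s • vertex R z * (b • vertex R z + m))) := by
      rw [← sub_eq_zero, ← h0, sub_neg_eq_add, add_mul (a • vertex R z), mul_add (s • vertex R z),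
        mul_add (a • vertex R z), ← add_assoc]
      congr 2
      simp only [smul_mul_assoc, vertex_mul_smul, vertex_mul_vertex_self, mul_smul]
    apply eq_zero_of_smul_vertex_mem_degreeLE (x := z)
    rw [h1]
    refine neg_mem (add_mem (mul_mem_degreeLE (hz a) (mul_mem_degreeLE (hz s) hm le_rfl)
      (by norm_num)) (mul_mem_degreeLE hn (mul_mem_degreeLE (hz s) (add_mem (hz b) ?_) le_rfl)
      (by norm_num)))
    exact degreeLE_mono (by norm_num) hm

end Reduction

/-! ### Necessity of both conditions -/

section Necessity

variable {R : Type u} [Ring R] {E : DirectedGraph.{v, w}}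

theorem vertex_mul_mul_vertex_eq_zero_of_not_reaches {d : ℕ} {p : LeavittPathRing R E}
    (hp : p ∈ pathSpan R E d) {x y : E.Vertex} (h : ¬ E.Reaches x y) :
    vertex R x * p * vertex R y = 0 := by
  induction hp using pathSpan_induction generalizing x with
  | vertex d z =>
    obtain rfl | hx := eq_or_ne x z
    · rw [vertex_mul_vertex_self, vertex_mul_vertex_of_ne]
      rintro rfl
      exact h ⟨[], rfl⟩
    · rw [vertex_mul_vertex_of_ne hx, zero_mul]
  | edge_mul d f p _ ih =>
    obtain rfl | hx := eq_or_ne x (E.s f)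
    · rw [← mul_assoc, vertex_source_mul_edge, ← edge_mul_vertex_range, mul_assoc _ _ p,
        mul_assoc, ih, mul_zero]
      rintro ⟨l, hl⟩
      exact h ⟨f :: l, rfl, hl⟩
    · rw [← mul_assoc, vertex_mul_edge_of_ne hx, zero_mul, zero_mul]
  | zero d => rw [mul_zero, zero_mul]
  | add d p q _ _ hp hq => rw [mul_add, add_mul, hp h, hq h, add_zero]
  | smul d c p _ hp => rw [vertex_mul_smul, smul_mul_assoc, hp h, smul_zero]

/-- A monomial `p q*` survives between `x` and `y` only if `p` starts at `x`, `q` starts at `y` and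
both end at one vertex. -/
theorem vertex_mul_mul_vertex_eq_zero {x y : E.Vertex}
    (h : ∀ z, E.Reaches x z → ¬ E.Reaches y z) (a : LeavittPathRing R E) :
    vertex R x * a * vertex R y = 0 := by
  obtain ⟨n, ha⟩ := exists_mem_monomialSpan a
  induction ha using monomialSpan_induction generalizing y with
  | path n d p hp =>
    exact vertex_mul_mul_vertex_eq_zero_of_not_reaches hp fun hxy => h y hxy ⟨[], rfl⟩
  | mul_ghost n f a _ ih =>
    obtain rfl | hy := eq_or_ne (E.s f) y
    · rw [mul_assoc, mul_assoc, ghost_mul_vertex_source, ← vertex_range_mul_ghost, ← mul_assoc,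
        ← mul_assoc, ih, zero_mul]
      rintro z hz ⟨l, hl⟩
      exact h z hz ⟨f :: l, rfl, hl⟩
    · rw [mul_assoc, mul_assoc, ghost_mul_vertex_of_ne hy, mul_zero, mul_zero]
  | add n a b _ _ ha hb => rw [mul_add, add_mul, ha h, hb h, add_zero]
  | smul n c a _ ha => rw [vertex_mul_smul, smul_mul_assoc, ha h, smul_zero]

theorem one_ne_zero_of_isPrimeRing (h : IsPrimeRing (LeavittPathRing R E)) : (1 : R) ≠ 0 := by
  intro h1
  refine h.1 (top_unique fun a _ => (TwoSidedIdeal.mem_bot _).2 ?_)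
  rw [← one_smul R a, h1, zero_smul]

theorem MT3_of_isPrimeRing (h : IsPrimeRing (LeavittPathRing R E)) : E.MT3 := by
  intro x y
  by_contra! hxy
  have hne (z : E.Vertex) : vertex R z ≠ 0 := fun hz =>
    one_ne_zero_of_isPrimeRing h (eq_zero_of_smul_vertex_eq_zero (x := z) (by rw [hz, smul_zero]))
  refine (h.eq_zero_or_eq_zero_of_mul_mul (vertex_mul_vertex_self x) fun a => ?_).elim
    (hne x) (hne y)
  rw [← mul_assoc]
  exact vertex_mul_mul_vertex_eq_zero hxy a

/-- This makes the annihilator of `A` a left ideal: elements of `A` pass through generators, and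
scalars met on the way are absorbed into `A`. -/
theorem smul_mul_eq_zero_of_forall {A : TwoSidedIdeal R} (y : LeavittPathRing R E) :
    ∀ x : LeavittPathRing R E, (∀ a ∈ A, a • x = 0) → ∀ a ∈ A, a • (y * x) = 0 := by
  induction y using generator_induction with
  | vertex z => exact fun x hx a ha => by rw [← vertex_mul_smul, hx a ha, mul_zero]
  | edge f => exact fun x hx a ha => by rw [← edge_mul_smul, hx a ha, mul_zero]
  | ghost f => exact fun x hx a ha => by rw [← ghost_mul_smul, hx a ha, mul_zero]
  | zero => exact fun x _ a _ => by rw [zero_mul, smul_zero]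
  | add y z hy hz =>
    exact fun x hx a ha => by rw [add_mul, smul_add, hy x hx a ha, hz x hx a ha, add_zero]
  | neg y hy => exact fun x hx a ha => by rw [neg_mul, smul_neg, hy x hx a ha, neg_zero]
  | mul y z hy hz => exact fun x hx a ha => by rw [mul_assoc]; exact hy _ (hz x hx) a ha
  | smul c y hy =>
    exact fun x hx a ha => by
      rw [smul_mul_assoc, smul_smul]; exact hy x hx _ (A.mul_mem_right _ _ ha)
  | op_smul c y hy =>
    intro x hx a ha
    rw [op_smul_mul]
    exact hy _ (fun b hb => by rw [smul_smul]; exact hx _ (A.mul_mem_right _ _ hb)) a ha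

theorem isPrimeRing_coefficients [Nonempty E.Vertex] (h : IsPrimeRing (LeavittPathRing R E)) :
    IsPrimeRing R := by
  obtain ⟨v⟩ := ‹Nonempty E.Vertex›
  refine ⟨fun htop => one_ne_zero_of_isPrimeRing h ?_, fun A B hAB => ?_⟩
  · rw [← TwoSidedIdeal.mem_bot, htop]
    exact TwoSidedIdeal.mem_top _
  · by_contra! hne
    obtain ⟨a, ha, ha0⟩ := TwoSidedIdeal.exists_mem_ne_zero hne.1
    obtain ⟨b, hb, hb0⟩ := TwoSidedIdeal.exists_mem_ne_zero hne.2
    -- `b v` lies in `J` because `AB = 0`, and `(a v) x = v (a x) = 0` for `x` in `J`.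
    let J : TwoSidedIdeal (LeavittPathRing R E) := .mk' {x | ∀ a ∈ A, a • x = 0}
      (fun _ _ => smul_zero _)
      (fun hx hy a ha => by rw [smul_add, hx a ha, hy a ha, add_zero])
      (fun hx a ha => by rw [smul_neg, hx a ha, neg_zero])
      (fun {y x} hx => smul_mul_eq_zero_of_forall y x hx)
      (fun hx a ha => by rw [← smul_mul_assoc, hx a ha, zero_mul])
    refine (h.eq_zero_or_eq_zero (J := J) (a := a • vertex R v) (b := b • vertex R v) ?_ ?_).elim
      (fun h => ha0 (eq_zero_of_smul_vertex_eq_zero h))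
      (fun h => hb0 (eq_zero_of_smul_vertex_eq_zero h))
    · intro x hx
      rw [smul_mul_assoc, ← vertex_mul_smul, (TwoSidedIdeal.mem_mk' _ _ _ _ _ _ _).1 hx a ha,
        mul_zero]
    · refine (TwoSidedIdeal.mem_mk' _ _ _ _ _ _ _).2 fun a ha => ?_
      rw [smul_smul, (TwoSidedIdeal.mem_bot R).1 (hAB a ha b hb), zero_smul]

end Necessity

end LeavittPathRing

theorem theorem4p4 (R : Type u) [Ring R] (E : DirectedGraph.{v, w}) [Nonempty E.Vertex] :
    IsPrimeRing (LeavittPathRing R E) ↔ IsPrimeRing R ∧ E.MT3 :=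
  ⟨fun h => ⟨LeavittPathRing.isPrimeRing_coefficients h, LeavittPathRing.MT3_of_isPrimeRing h⟩,
    fun h => LeavittPathRing.isPrimeRing_of_MT3 h.1 h.2⟩
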